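/- Let $n \ge 2$ be an integer, let $H_n$ denote the set of all $n \times n$ complex hermitian matrices, and let $\phi : H_n \to H_n$ be a bijective map such that $$\phi(ABA) = \phi(A)\,\phi(B)\,\phi(A) \quad \text{for all } A, B \in H_n.$$ Then there exist $c \in \{-1, 1\}$ and a unitary $n \times n$ complex matrix $U$ such that either $\phi(A) = c\,U A U^*$ for every $A \in H_n$, or $\phi(A) = c\,U A^t U^*$ for every $A \in H_n$. Here $A^t$ is the transpose of $A$ and $U^*$ is the conjugate transpose of $U$. -/

import Mathlib

/-- The set of all `n × n` complex hermitian matrices. -/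
abbrev HermMat (n : ℕ) : Type :=
  {A : Matrix (Fin n) (Fin n) ℂ // A.IsHermitian}

/-- The Jordan triple product `A B A` of two hermitian matrices, which is again hermitian. -/
def HermMat.triple {n : ℕ} (A B : HermMat n) : HermMat n :=
  ⟨A.1 * B.1 * A.1, by
    show (A.1 * B.1 * A.1).conjTranspose = A.1 * B.1 * A.1
    rw [Matrix.conjTranspose_mul, Matrix.conjTranspose_mul, A.2.eq, B.2.eq, Matrix.mul_assoc]⟩

/-! The image J of 1 satisfies JCJ = C for all C, so J = ±1, and up to sign the map is unital
(`map_one`). It then permutes the rank-one projections, since these are the minimal ones and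
minimality is expressible by triple products.

Scalars go to scalars (`exists_map_smul_one`), giving f : ℝ → ℝ with f(s²t) = f(s)²f(t). If xx* maps
to yy*, compressing gives y*φ(A)y = f(x*Ax). Mapping the standard basis projections to a resolution
of the identity yields ∑ f(|xᵢ|²) = 1 for unit x. As n ≥ 2, this makes f additive, so f is a ring
endomorphism of ℝ and hence the identity.

Thus φ preserves the values x*Ax, which determine a matrix, so φ is real linear
(`exists_linearMap`). Its complex extension is a Jordan map of the full matrix algebra, hence
multiplicative or antimultiplicative (`map_mul_or_map_mul_rev`); matrix units then produce U. -/

set_option linter.unusedSectionVars false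

section

open Matrix ComplexStarModule

variable {ι : Type*} [Fintype ι] [DecidableEq ι]

/-! ### Rank-one matrices as a separating and spanning family -/

/-- The rank-one matrix `x xᴴ`. -/
def rankOne (x : ι → ℂ) : Matrix ι ι ℂ := vecMulVec x (star x)

lemma rankOne_isHermitian (x : ι → ℂ) : (rankOne x)ᴴ = rankOne x := by
  simp [rankOne, conjTranspose_vecMulVec]

lemma rankOne_mul_mul_rankOne (x : ι → ℂ) (A : Matrix ι ι ℂ) :
    rankOne x * A * rankOne x = (star x ⬝ᵥ A *ᵥ x) • rankOne x := by
  rw [Matrix.mul_assoc, rankOne, mul_vecMulVec, vecMulVec_mul_vecMulVec]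
  ext i j
  simp [vecMulVec_apply]
  ring

lemma trace_rankOne_mul (x : ι → ℂ) (A : Matrix ι ι ℂ) :
    (rankOne x * A).trace = star x ⬝ᵥ A *ᵥ x := by
  rw [trace_mul_comm, rankOne, mul_vecMulVec, trace_vecMulVec, dotProduct_comm]

lemma rankOne_mul_self {x : ι → ℂ} (hx : star x ⬝ᵥ x = 1) :
    rankOne x * rankOne x = rankOne x := by
  simpa [hx] using rankOne_mul_mul_rankOne x 1

lemma rankOne_smul (c : ℂ) (x : ι → ℂ) : rankOne (c • x) = (c * star c) • rankOne x := by
  ext i j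
  simp [rankOne, vecMulVec_apply]
  ring

lemma rankOne_single (i : ι) : rankOne (Pi.single i (1 : ℂ)) = single i i 1 := by
  rw [single_eq_single_vecMulVec_single]
  simp [rankOne]

lemma star_dotProduct_eq_ofReal (x : ι → ℂ) :
    star x ⬝ᵥ x = ((∑ i, Complex.normSq (x i) : ℝ) : ℂ) := by
  simp [dotProduct, Complex.normSq_eq_conj_mul_self]

lemma exists_smul_unit {x : ι → ℂ} (hx : x ≠ 0) :
    ∃ (c : ℂ) (y : ι → ℂ), x = c • y ∧ star y ⬝ᵥ y = 1 := by
  have hs : 0 < ∑ i, Complex.normSq (x i) := by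
    obtain ⟨i, hi⟩ := Function.ne_iff.1 hx
    exact Finset.sum_pos' (fun i _ => Complex.normSq_nonneg _)
      ⟨i, Finset.mem_univ _, Complex.normSq_pos.2 hi⟩
  set s := ∑ i, Complex.normSq (x i) with hsd
  have hr : ((√s : ℝ) : ℂ) ≠ 0 := by exact_mod_cast (Real.sqrt_pos.2 hs).ne'
  refine ⟨(√s : ℝ), ((√s : ℝ) : ℂ)⁻¹ • x, by rw [smul_smul, mul_inv_cancel₀ hr, one_smul], ?_⟩
  have h2 : ((√s : ℝ) : ℂ) * (√s : ℝ) = s := by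
    rw [← Complex.ofReal_mul, Real.mul_self_sqrt hs.le]
  rw [star_smul, smul_dotProduct, dotProduct_smul, star_dotProduct_eq_ofReal, ← hsd, ← h2]
  simp
  field_simp

/-- A linear map killing every rank-one projection vanishes. -/
lemma linearMap_eq_zero_of_rankOne {N : Type*} [AddCommGroup N] [Module ℂ N]
    (L : Matrix ι ι ℂ →ₗ[ℂ] N) (h : ∀ x : ι → ℂ, star x ⬝ᵥ x = 1 → L (rankOne x) = 0) :
    L = 0 := by
  have h' : ∀ x, L (rankOne x) = 0 := by
    intro x
    rcases eq_or_ne x 0 with rfl | hx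
    · simp [rankOne]
    · obtain ⟨c, y, rfl, hy⟩ := exists_smul_unit hx
      rw [rankOne_smul, map_smul, h y hy, smul_zero]
  -- Polarization: the factor I on the second term cancels the unwanted `y xᴴ`.
  have key : ∀ x y : ι → ℂ, (2 : ℂ) • vecMulVec x (star y) = rankOne (x + y)
      + Complex.I • rankOne (x + Complex.I • y)
      - (1 + Complex.I) • rankOne x - (1 + Complex.I) • rankOne y := by
    intro x y
    ext i j
    simp [rankOne, vecMulVec_apply]
    linear_combination (x i * starRingEnd ℂ (y j) - y i * starRingEnd ℂ (x j)
      + Complex.I * y i * starRingEnd ℂ (y j)) * Complex.I_mul_I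
  refine Matrix.ext_linearMap ℂ fun i j => LinearMap.ext_ring ?_
  have hk := congrArg L (key (Pi.single i 1) (Pi.single j 1))
  rw [map_sub, map_sub, map_add] at hk
  simp only [map_smul, h', smul_zero, add_zero, sub_zero] at hk
  have := (smul_eq_zero.1 hk).resolve_left two_ne_zero
  simpa [single_eq_single_vecMulVec_single, Pi.single_star] using this

lemma eq_of_trace_rankOne {A B : Matrix ι ι ℂ}
    (h : ∀ x : ι → ℂ, star x ⬝ᵥ x = 1 → (rankOne x * A).trace = (rankOne x * B).trace) :
    A = B := by
  let L : Matrix ι ι ℂ →ₗ[ℂ] ℂ :=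
    traceLinearMap ι ℂ ℂ ∘ₗ LinearMap.mulRight ℂ (A - B)
  have hL : L = 0 := linearMap_eq_zero_of_rankOne L fun x hx => by
    simp [L, Matrix.mul_sub, h x hx]
  ext i j
  have := LinearMap.congr_fun hL (single j i 1)
  simpa [L, trace_single_mul, sub_eq_zero] using this

lemma exists_scalar_of_commute_rankOne {A : Matrix ι ι ℂ}
    (h : ∀ x : ι → ℂ, star x ⬝ᵥ x = 1 → A * rankOne x = rankOne x * A) :
    ∃ c : ℂ, A = c • 1 := by
  let L : Matrix ι ι ℂ →ₗ[ℂ] Matrix ι ι ℂ := LinearMap.mulLeft ℂ A - LinearMap.mulRight ℂ A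
  have hL : L = 0 := linearMap_eq_zero_of_rankOne L fun x hx => by simp [L, h x hx]
  obtain ⟨c, hc⟩ := mem_range_scalar_of_commute_single (M := A) fun i j _ => by
    have := LinearMap.congr_fun hL (single i j 1)
    simp only [L, LinearMap.sub_apply, LinearMap.mulLeft_apply, LinearMap.mulRight_apply,
      LinearMap.zero_apply, sub_eq_zero] at this
    exact this.symm
  exact ⟨c, by rw [← hc]; ext i j; simp [Matrix.one_apply, diagonal_apply]⟩

/-! ### Hermitian matrices and minimal projections -/

/-- Hermitian matrices as a real vector space. -/
abbrev Herm (ι : Type*) [Fintype ι] [DecidableEq ι] : Type _ := selfAdjoint (Matrix ι ι ℂ)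

namespace Herm

lemma star_coe (A : Herm ι) : (A : Matrix ι ι ℂ)ᴴ = A := A.2

lemma exists_real_scalar_of_commute_rankOne [Nonempty ι] {A : Herm ι}
    (h : ∀ x : ι → ℂ, star x ⬝ᵥ x = 1 →
      (A : Matrix ι ι ℂ) * rankOne x = rankOne x * (A : Matrix ι ι ℂ)) :
    ∃ c : ℝ, A = c • (1 : Herm ι) := by
  obtain ⟨c, hc⟩ := _root_.exists_scalar_of_commute_rankOne h
  have hs := A.star_coe
  obtain ⟨i⟩ := ‹Nonempty ι›
  have h1 := congrFun (congrFun hs i) i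
  rw [hc] at h1
  simp at h1
  obtain ⟨r, rfl⟩ := Complex.conj_eq_iff_real.1 h1
  refine ⟨r, Subtype.ext ?_⟩
  rw [hc]
  ext i j
  simp

/-- The rank-one hermitian matrix `x xᴴ`. -/
def ofVec (x : ι → ℂ) : Herm ι := ⟨rankOne x, rankOne_isHermitian x⟩

@[simp] lemma coe_ofVec (x : ι → ℂ) : (ofVec x : Matrix ι ι ℂ) = rankOne x := rfl

/-- The Jordan triple product `A B A`. -/
def jtriple (A B : Herm ι) : Herm ι :=
  ⟨(A : Matrix ι ι ℂ) * B * A, by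
    simp [selfAdjoint.mem_iff, star_eq_conjTranspose, star_coe, Matrix.mul_assoc]⟩

@[simp] lemma coe_jtriple (A B : Herm ι) :
    (jtriple A B : Matrix ι ι ℂ) = (A : Matrix ι ι ℂ) * B * A := rfl

/-- Minimal nonzero projections, described by the triple product. -/
structure IsMinProj (P : Herm ι) : Prop where
  proj : jtriple P 1 = P
  ne_zero : P ≠ 0
  minimal : ∀ Q, jtriple Q 1 = Q → jtriple P Q = Q → Q = 0 ∨ Q = P

lemma isMinProj_ofVec {x : ι → ℂ} (hx : star x ⬝ᵥ x = 1) : IsMinProj (ofVec x) where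
  proj := Subtype.ext (by simpa using rankOne_mul_self hx)
  ne_zero h := by
    have h1 := congrArg (fun A : Herm ι => (A : Matrix ι ι ℂ).trace) h
    have h2 := trace_rankOne_mul x 1
    simp [hx] at h1 h2
    simp [h1] at h2
  minimal Q hQ hPQ := by
    have h1 := congrArg Subtype.val hPQ
    have h2 := congrArg Subtype.val hQ
    simp only [coe_jtriple, coe_ofVec, rankOne_mul_mul_rankOne, selfAdjoint.val_one,
      Matrix.mul_one] at h1 h2
    set c := star x ⬝ᵥ (Q : Matrix ι ι ℂ) *ᵥ x
    rcases eq_or_ne (Q : Matrix ι ι ℂ) 0 with h0 | h0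
    · exact Or.inl (Subtype.ext h0)
    right
    refine Subtype.ext ?_
    rw [← h1, smul_mul_smul_comm, rankOne_mul_self hx] at h2
    have hc : c * c = c := by
      by_contra hne
      have h3 : (c * c - c) • rankOne x = 0 := by rw [sub_smul, h2, sub_self]
      have h4 := (smul_eq_zero.1 h3).resolve_left (sub_ne_zero.2 hne)
      rw [h4, smul_zero] at h1
      exact h0 h1.symm
    rcases IsIdempotentElem.iff_eq_zero_or_one.1 hc with h3 | h3
    · rw [h3, zero_smul] at h1; exact absurd h1.symm h0
    · rw [h3, one_smul] at h1; exact h1.symm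

/-- A unit vector y in the range of P gives a nonzero projection yy* below P, so minimality forces
equality. -/
lemma IsMinProj.exists_ofVec {P : Herm ι} (hP : IsMinProj P) :
    ∃ x : ι → ℂ, star x ⬝ᵥ x = 1 ∧ P = ofVec x := by
  have hpp : (P : Matrix ι ι ℂ) * P = P := by simpa using congrArg Subtype.val hP.proj
  have h0 : (P : Matrix ι ι ℂ) ≠ 0 := fun h => hP.ne_zero (Subtype.ext h)
  obtain ⟨v, hv⟩ : ∃ v, (P : Matrix ι ι ℂ) *ᵥ v ≠ 0 := by
    by_contra! h
    exact h0 (Matrix.ext_of_mulVec_single fun i => by rw [h, zero_mulVec])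
  obtain ⟨c, y, hy, hy1⟩ := exists_smul_unit hv
  have hc : c ≠ 0 := by rintro rfl; simp [hy] at hv
  have hPy : (P : Matrix ι ι ℂ) *ᵥ y = y := by
    have h1 : (P : Matrix ι ι ℂ) *ᵥ (c • y) = c • y := by rw [← hy, mulVec_mulVec, hpp]
    rw [mulVec_smul] at h1
    exact smul_right_injective _ hc h1
  refine ⟨y, hy1, ?_⟩
  have hQ := isMinProj_ofVec hy1
  have hPQ : (P : Matrix ι ι ℂ) * rankOne y = rankOne y := by
    rw [rankOne, mul_vecMulVec, hPy]
  have hQP : rankOne y * (P : Matrix ι ι ℂ) = rankOne y := by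
    have := congrArg conjTranspose hPQ
    rwa [conjTranspose_mul, star_coe, rankOne_isHermitian] at this
  exact ((hP.minimal _ hQ.proj (Subtype.ext (by simp [hPQ, hQP]))).resolve_left hQ.ne_zero).symm

end Herm

namespace Herm

lemma star_dotProduct_mulVec_eq_ofReal (A : Herm ι) (x : ι → ℂ) :
    star x ⬝ᵥ (A : Matrix ι ι ℂ) *ᵥ x =
      ((star x ⬝ᵥ (A : Matrix ι ι ℂ) *ᵥ x).re : ℂ) := by
  have h : (A : Matrix ι ι ℂ).IsHermitian := A.2
  exact Complex.ext rfl (by simpa using h.im_star_dotProduct_mulVec_self x)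

lemma jtriple_ofVec (x : ι → ℂ) (A : Herm ι) :
    jtriple (ofVec x) A = (star x ⬝ᵥ (A : Matrix ι ι ℂ) *ᵥ x).re • ofVec x := by
  refine Subtype.ext ?_
  rw [coe_jtriple, coe_ofVec, rankOne_mul_mul_rankOne, star_dotProduct_mulVec_eq_ofReal]
  simp

lemma coe_smul_real (r : ℝ) (A : Herm ι) :
    ((r • A : Herm ι) : Matrix ι ι ℂ) = (r : ℂ) • (A : Matrix ι ι ℂ) := by
  simp

/-! ### Triple isomorphisms: normalization and action on scalars -/

/-- A bijection of the hermitian matrices multiplicative for the Jordan triple product. -/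
def IsTripleIso (e : Herm ι ≃ Herm ι) : Prop :=
  ∀ A B, e (jtriple A B) = jtriple (e A) (e B)

namespace IsTripleIso

variable {e : Herm ι ≃ Herm ι}

lemma symm (he : IsTripleIso e) : IsTripleIso e.symm := fun A B => by
  rw [Equiv.symm_apply_eq, he, e.apply_symm_apply, e.apply_symm_apply]

lemma map_zero (he : IsTripleIso e) : e 0 = 0 := by
  have h0 : ∀ B : Herm ι, jtriple 0 B = 0 := fun B => Subtype.ext (by simp)
  have h1 := he 0 (e.symm 0)
  rw [h0, e.apply_symm_apply] at h1
  rw [h1]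
  exact Subtype.ext (by simp)

lemma isMinProj (he : IsTripleIso e) (h1 : e 1 = 1) {P : Herm ι} (hP : IsMinProj P) :
    IsMinProj (e P) where
  proj := by rw [← h1, ← he, hP.proj]
  ne_zero h := hP.ne_zero (e.injective (h.trans he.map_zero.symm))
  minimal Q hQ hPQ := by
    obtain ⟨R, rfl⟩ := e.surjective Q
    rw [← he, e.injective.eq_iff] at hPQ
    rw [← h1, ← he, e.injective.eq_iff] at hQ
    exact (hP.minimal R hQ hPQ).imp (fun h => by rw [h, he.map_zero]) (fun h => by rw [h])

lemma exists_map_ofVec (he : IsTripleIso e) (h1 : e 1 = 1) {x : ι → ℂ} (hx : star x ⬝ᵥ x = 1) :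
    ∃ y : ι → ℂ, star y ⬝ᵥ y = 1 ∧ e (ofVec x) = ofVec y :=
  (he.isMinProj h1 (isMinProj_ofVec hx)).exists_ofVec

lemma exists_ofVec_eq_map (he : IsTripleIso e) (h1 : e 1 = 1) {y : ι → ℂ}
    (hy : star y ⬝ᵥ y = 1) :
    ∃ x : ι → ℂ, star x ⬝ᵥ x = 1 ∧ e (ofVec x) = ofVec y := by
  obtain ⟨x, hx, h⟩ := he.symm.exists_map_ofVec (by rw [Equiv.symm_apply_eq, h1]) hy
  exact ⟨x, hx, by rw [← h, e.apply_symm_apply]⟩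

/-- The image of the identity is a real scalar squaring to one. -/
lemma map_one [Nonempty ι] (he : IsTripleIso e) : e 1 = 1 ∨ e 1 = -1 := by
  have hJ : ∀ C : Herm ι, jtriple (e 1) C = C := fun C => by
    obtain ⟨B, rfl⟩ := e.surjective C
    rw [← he]
    exact congrArg e (Subtype.ext (by simp))
  have hJ' : ∀ C : Herm ι, (e 1 : Matrix ι ι ℂ) * C * (e 1 : Matrix ι ι ℂ) = C := fun C =>
    congrArg Subtype.val (hJ C)
  have hsq : (e 1 : Matrix ι ι ℂ) * e 1 = 1 := by simpa using hJ' 1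
  obtain ⟨c, hc⟩ := exists_real_scalar_of_commute_rankOne (A := e 1) fun x _ => by
    -- Multiplying JCJ = C on the right by J, with J² = 1, gives JC = CJ.
    have := congrArg (· * (e 1 : Matrix ι ι ℂ)) (hJ' (ofVec x))
    simpa [Matrix.mul_assoc, hsq] using this
  have hcc : c * c = 1 := by
    obtain ⟨i⟩ := ‹Nonempty ι›
    have := congrFun (congrFun hsq i) i
    rw [hc] at this
    simp at this
    exact_mod_cast this
  rcases mul_self_eq_one_iff.1 hcc with rfl | rfl
  · left; rw [hc, one_smul]
  · right; rw [hc, neg_smul, one_smul]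

lemma neg (he : IsTripleIso e) : IsTripleIso (e.trans (Equiv.neg _)) := fun A B => by
  refine Subtype.ext ?_
  simp [he A B]

open scoped ComplexOrder in
/-- Real scalar matrices are mapped to real scalar matrices. -/
lemma exists_map_smul_one [Nonempty ι] (he : IsTripleIso e) (h1 : e 1 = 1) (s : ℝ) :
    ∃ r : ℝ, e (s • 1) = r • 1 := by
  refine exists_real_scalar_of_commute_rankOne fun y hy => ?_
  obtain ⟨x, hx, hxy⟩ := he.exists_ofVec_eq_map h1 hy
  set A : Matrix ι ι ℂ := (e (s • 1)).1 with hA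
  have hAh : Aᴴ = A := star_coe _
  set Q := rankOne y
  have hQ : Qᴴ = Q := rankOne_isHermitian y
  have hQQ : Q * Q = Q := rankOne_mul_self hy
  -- For scalar S, SPS = PS²P; both sides are triple products, so the identity transports to AQA =
  -- QA²Q.
  have hAA : jtriple (s • 1 : Herm ι) (ofVec x)
      = jtriple (ofVec x) (jtriple (s • 1 : Herm ι) 1) := by
    refine Subtype.ext ?_
    simp [rankOne_mul_self hx]
  have key : A * Q * A = Q * (A * A) * Q := by
    have := congrArg Subtype.val (congrArg e hAA)
    rw [he, he, he, hxy, h1] at this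
    simpa using this
  -- The off-diagonal block D = QA(1 - Q) has D*D = (1 - Q)AQA(1 - Q), which vanishes by `key`.
  have hD : (Q * A * (1 - Q))ᴴ * (Q * A * (1 - Q)) = 0 := by
    simp only [conjTranspose_mul, conjTranspose_sub, conjTranspose_one, hQ, hAh]
    have : (1 - Q) * (A * Q) * (Q * A * (1 - Q)) = (1 - Q) * (A * (Q * Q) * A) * (1 - Q) := by
      noncomm_ring
    rw [this, hQQ, key]
    have : (1 - Q) * (Q * (A * A) * Q) * (1 - Q)
        = (Q - Q * Q) * (A * A) * (Q * (1 - Q)) := by noncomm_ring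
    rw [this, hQQ, sub_self]
    simp
  have h2 : Q * A = Q * A * Q := by
    have := conjTranspose_mul_self_eq_zero.1 hD
    rwa [Matrix.mul_sub, Matrix.mul_one, sub_eq_zero] at this
  have h3 : A * Q = Q * A * Q := by
    have := congrArg conjTranspose h2
    simpa only [conjTranspose_mul, hQ, hAh, Matrix.mul_assoc] using this
  rw [h3, ← h2]

/-- The multiplicative function through which a unital triple isomorphism acts on scalars. -/
noncomputable def scalarMap [Nonempty ι] (he : IsTripleIso e) (h1 : e 1 = 1) (s : ℝ) : ℝ :=
  (he.exists_map_smul_one h1 s).choose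

lemma map_smul_one [Nonempty ι] (he : IsTripleIso e) (h1 : e 1 = 1) (s : ℝ) :
    e (s • 1) = he.scalarMap h1 s • 1 :=
  (he.exists_map_smul_one h1 s).choose_spec

lemma smul_one_injective [Nonempty ι] : Function.Injective fun s : ℝ => (s • 1 : Herm ι) := by
  intro s t h
  obtain ⟨i⟩ := ‹Nonempty ι›
  have := congrFun (congrFun (congrArg Subtype.val h) i) i
  simpa using this

lemma scalarMap_one [Nonempty ι] (he : IsTripleIso e) (h1 : e 1 = 1) :
    he.scalarMap h1 1 = 1 :=
  smul_one_injective (ι := ι) (by simp [← map_smul_one, h1])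

lemma scalarMap_zero [Nonempty ι] (he : IsTripleIso e) (h1 : e 1 = 1) :
    he.scalarMap h1 0 = 0 :=
  smul_one_injective (ι := ι) (by simp [← map_smul_one, he.map_zero])

lemma scalarMap_injective [Nonempty ι] (he : IsTripleIso e) (h1 : e 1 = 1) :
    Function.Injective (he.scalarMap h1) := fun s t h =>
  smul_one_injective (ι := ι) (e.injective (by
    change e (s • 1) = e (t • 1)
    rw [he.map_smul_one h1, he.map_smul_one h1, h]))

lemma scalarMap_mul_self_mul [Nonempty ι] (he : IsTripleIso e) (h1 : e 1 = 1) (s t : ℝ) :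
    he.scalarMap h1 (s * s * t) = he.scalarMap h1 s * he.scalarMap h1 s * he.scalarMap h1 t := by
  have hj : ∀ a b : ℝ, jtriple (a • 1 : Herm ι) (b • 1) = (a * a * b) • 1 := fun a b => by
    refine Subtype.ext ?_
    simp [smul_smul]
    ring_nf
  refine smul_one_injective (ι := ι) ?_
  change _ • _ = _ • _
  rw [← map_smul_one, ← hj, he, map_smul_one he h1, map_smul_one he h1, hj]

lemma scalarMap_mul_self [Nonempty ι] (he : IsTripleIso e) (h1 : e 1 = 1) (s : ℝ) :
    he.scalarMap h1 (s * s) = he.scalarMap h1 s * he.scalarMap h1 s := by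
  simpa [scalarMap_one he h1] using he.scalarMap_mul_self_mul h1 s 1

lemma scalarMap_mul_of_nonneg [Nonempty ι] (he : IsTripleIso e) (h1 : e 1 = 1) {s : ℝ}
    (hs : 0 ≤ s) (t : ℝ) :
    he.scalarMap h1 (s * t) = he.scalarMap h1 s * he.scalarMap h1 t := by
  rw [← Real.mul_self_sqrt hs, scalarMap_mul_self_mul, scalarMap_mul_self]

lemma scalarMap_neg [Nonempty ι] (he : IsTripleIso e) (h1 : e 1 = 1) (t : ℝ) :
    he.scalarMap h1 (-t) = -he.scalarMap h1 t := by
  have hm : he.scalarMap h1 (-1) = -1 := by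
    have h := he.scalarMap_mul_self h1 (-1)
    rw [neg_one_mul, neg_neg, scalarMap_one] at h
    refine (mul_self_eq_one_iff.1 h.symm).resolve_left fun h' => ?_
    have := he.scalarMap_injective h1 (h'.trans (he.scalarMap_one h1).symm)
    norm_num at this
  have hp : ∀ t : ℝ, 0 ≤ t → he.scalarMap h1 (-t) = -he.scalarMap h1 t := fun t ht => by
    rw [neg_eq_neg_one_mul, mul_comm, scalarMap_mul_of_nonneg he h1 ht, hm, mul_neg_one]
  rcases le_total 0 t with ht | ht
  · exact hp t ht
  · have := hp (-t) (by linarith)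
    rw [neg_neg] at this
    rw [this, neg_neg]

/-! ### The scalar map is the identity -/

/-- The compression of `e A` to the image of a rank-one projection. -/
lemma re_dotProduct_map [Nonempty ι] (he : IsTripleIso e) (h1 : e 1 = 1) {x y : ι → ℂ}
    (hy : star y ⬝ᵥ y = 1) (hxy : e (ofVec x) = ofVec y) (A : Herm ι) :
    (star y ⬝ᵥ (e A : Matrix ι ι ℂ) *ᵥ y).re =
      he.scalarMap h1 (star x ⬝ᵥ (A : Matrix ι ι ℂ) *ᵥ x).re := by
  have hs : ∀ t : ℝ, e (t • ofVec x) = he.scalarMap h1 t • ofVec y := fun t => by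
    have hPP : jtriple (ofVec y) 1 = ofVec y := (isMinProj_ofVec hy).proj
    have hPx : jtriple (ofVec x) 1 = ofVec x :=
      e.injective (by rw [he, h1, hxy, hPP])
    have hj : ∀ (P : Herm ι) (r : ℝ), jtriple P 1 = P → jtriple P (r • 1) = r • P :=
      fun P r hP => by
        conv_rhs => rw [← hP]
        exact Subtype.ext (by simp)
    rw [← hj _ t hPx, he, hxy, map_smul_one he h1, hj _ _ hPP]
  have h := he (ofVec x) A
  rw [hxy, jtriple_ofVec, jtriple_ofVec, hs] at h
  exact (smul_left_injective ℝ (isMinProj_ofVec hy).ne_zero h).symm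

/-- The rank-one projections of the standard basis are mapped to a resolution of the identity. -/
lemma sum_rankOne_eq_one (he : IsTripleIso e) {u : ι → ι → ℂ}
    (hu : ∀ i, star (u i) ⬝ᵥ u i = 1)
    (he_u : ∀ i, e (ofVec (Pi.single i 1)) = ofVec (u i)) : ∑ i, rankOne (u i) = 1 := by
  -- Orthogonality is the triple identity PᵢPⱼPᵢ = 0, whose image says |⟨uᵢ, uⱼ⟩|² = 0.
  have ho : ∀ i j, i ≠ j → star (u i) ⬝ᵥ u j = 0 := fun i j hij => by
    have h0 : jtriple (ofVec (Pi.single i 1)) (ofVec (Pi.single j 1)) = (0 : Herm ι) :=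
      Subtype.ext (by simp [rankOne_single, hij])
    have h := congrArg Subtype.val (congrArg e h0)
    rw [he, he.map_zero, he_u, he_u] at h
    simp only [coe_jtriple, coe_ofVec, rankOne_mul_mul_rankOne, ZeroMemClass.coe_zero] at h
    have hne : rankOne (u i) ≠ 0 := fun h0 => (isMinProj_ofVec (hu i)).ne_zero (Subtype.ext h0)
    have h2 := (smul_eq_zero.1 h).resolve_right hne
    rw [rankOne, vecMulVec_mulVec, dotProduct_smul] at h2
    have h3 : star (u j) ⬝ᵥ u i = star (star (u i) ⬝ᵥ u j) := by
      rw [star_dotProduct, dotProduct_comm]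
    rw [h3] at h2
    simpa using h2
  let U : Matrix ι ι ℂ := of fun a i => u i a
  have hU : Uᴴ * U = 1 := by
    ext i j
    have : (Uᴴ * U) i j = star (u i) ⬝ᵥ u j := by simp [U, mul_apply, dotProduct]
    rw [this]
    rcases eq_or_ne i j with rfl | hij
    · simp [hu]
    · simp [ho i j hij, hij]
  rw [mul_eq_one_comm] at hU
  rw [← hU]
  ext a b
  simp [U, mul_apply, Matrix.sum_apply, rankOne, vecMulVec_apply]

/-- Preservation of the trace of rank-one projections, in terms of the scalar map. -/
lemma sum_scalarMap_normSq [Nonempty ι] (he : IsTripleIso e) (h1 : e 1 = 1) {x : ι → ℂ}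
    (hx : star x ⬝ᵥ x = 1) : ∑ i, he.scalarMap h1 (Complex.normSq (x i)) = 1 := by
  obtain ⟨y, hy, hxy⟩ := he.exists_map_ofVec h1 hx
  choose u hu he_u using fun i : ι =>
    he.exists_map_ofVec h1 (x := Pi.single i 1) (by simp)
  have hsum := he.sum_rankOne_eq_one hu he_u
  have h2 : ∀ i, he.scalarMap h1 (Complex.normSq (x i)) = (rankOne (u i) * rankOne y).trace.re :=
    fun i => by
      have := he.re_dotProduct_map h1 (hu i) (he_u i) (ofVec x)
      rw [hxy] at this
      rw [trace_rankOne_mul, ← coe_ofVec, this]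
      congr 1
      simp [rankOne, vecMulVec_apply, Complex.mul_conj]
  simp only [h2]
  rw [← Complex.re_sum, ← trace_sum, ← Finset.sum_mul, hsum, Matrix.one_mul]
  simpa [hy] using congrArg Complex.re (trace_rankOne_mul y 1)

/-- A unit vector with two coordinates √t, √(1 - t) gives f(t) + f(1 - t) = 1; multiplicativity
rescales this to nonnegative a, b, and oddness handles the signs. -/
lemma scalarMap_add [Nontrivial ι] (he : IsTripleIso e) (h1 : e 1 = 1) (a b : ℝ) :
    he.scalarMap h1 (a + b) = he.scalarMap h1 a + he.scalarMap h1 b := by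
  set f := he.scalarMap h1 with hf
  have h01 : ∀ t : ℝ, 0 ≤ t → t ≤ 1 → f t + f (1 - t) = 1 := by
    intro t h0 h1'
    obtain ⟨i, j, hij⟩ := exists_pair_ne ι
    let x : ι → ℂ := fun k => if k = i then (√t : ℝ) else if k = j then (√(1 - t) : ℝ) else 0
    have hn : ∀ k, Complex.normSq (x k) = if k = i then t else if k = j then 1 - t else 0 := by
      intro k
      simp only [x]
      split_ifs
      · rw [Complex.normSq_ofReal, Real.mul_self_sqrt h0]
      · rw [Complex.normSq_ofReal, Real.mul_self_sqrt (by linarith)]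
      · simp
    have hsum : ∀ g : ℝ → ℝ, g 0 = 0 → ∑ k, g (Complex.normSq (x k)) = g t + g (1 - t) := by
      intro g hg
      rw [Fintype.sum_eq_add i j hij fun k hk => by rw [hn, if_neg hk.1, if_neg hk.2, hg],
        hn, hn, if_pos rfl, if_neg hij.symm, if_pos rfl]
    have hx : star x ⬝ᵥ x = 1 := by
      rw [star_dotProduct_eq_ofReal, show ∑ k, Complex.normSq (x k) = t + (1 - t) from hsum id rfl]
      simp
    rw [← hsum f (he.scalarMap_zero h1)]
    exact he.sum_scalarMap_normSq h1 hx
  have hpos : ∀ a b : ℝ, 0 ≤ a → 0 ≤ b → f (a + b) = f a + f b := by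
    intro a b ha hb
    rcases (add_nonneg ha hb).eq_or_lt with h | h
    · have ha' : a = 0 := by linarith
      have hb' : b = 0 := by linarith
      simp [ha', hb', hf, he.scalarMap_zero h1]
    · have h2 := h01 (a / (a + b)) (by positivity) ((div_le_one h).2 (by linarith))
      have h3 : 1 - a / (a + b) = b / (a + b) := by field_simp; ring
      have h4 : f a = f (a + b) * f (a / (a + b)) := by
        rw [hf, ← he.scalarMap_mul_of_nonneg h1 h.le, mul_div_cancel₀ _ h.ne']
      have h5 : f b = f (a + b) * f (b / (a + b)) := by
        rw [hf, ← he.scalarMap_mul_of_nonneg h1 h.le, mul_div_cancel₀ _ h.ne']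
      rw [h3] at h2
      rw [h4, h5, ← mul_add, h2, mul_one]
  have hneg : ∀ t, f (-t) = -f t := he.scalarMap_neg h1
  have hmix : ∀ a b : ℝ, 0 ≤ a → b ≤ 0 → f (a + b) = f a + f b := by
    intro a b ha hb
    rcases le_total 0 (a + b) with h | h
    · have := hpos (a + b) (-b) h (by linarith)
      rw [add_neg_cancel_right, hneg] at this
      linarith
    · have := hpos (-(a + b)) a (by linarith) ha
      rw [show -(a + b) + a = -b by ring, hneg, hneg] at this
      linarith
  rcases le_total 0 a with ha | ha <;> rcases le_total 0 b with hb | hb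
  · exact hpos a b ha hb
  · exact hmix a b ha hb
  · rw [add_comm, hmix b a hb ha, add_comm]
  · have := hpos (-a) (-b) (by linarith) (by linarith)
    rw [← neg_add, hneg, hneg, hneg] at this
    linarith

lemma scalarMap_eq [Nontrivial ι] (he : IsTripleIso e) (h1 : e 1 = 1) (t : ℝ) :
    he.scalarMap h1 t = t := by
  let F : ℝ →+* ℝ :=
    { toFun := he.scalarMap h1
      map_one' := he.scalarMap_one h1
      map_zero' := he.scalarMap_zero h1
      map_add' := he.scalarMap_add h1
      map_mul' := fun s t => by
        rcases le_total 0 s with hs | hs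
        · exact he.scalarMap_mul_of_nonneg h1 hs t
        · have := he.scalarMap_mul_of_nonneg h1 (neg_nonneg.2 hs) t
          rw [neg_mul, scalarMap_neg, scalarMap_neg, neg_mul] at this
          exact neg_injective this }
  exact RingHom.congr_fun (Subsingleton.elim F (RingHom.id ℝ)) t

/-! ### Real linearity -/

/-- Transition values are preserved. -/
lemma dotProduct_map [Nontrivial ι] (he : IsTripleIso e) (h1 : e 1 = 1) {x y : ι → ℂ}
    (hy : star y ⬝ᵥ y = 1) (hxy : e (ofVec x) = ofVec y) (A : Herm ι) :
    star y ⬝ᵥ (e A : Matrix ι ι ℂ) *ᵥ y = star x ⬝ᵥ (A : Matrix ι ι ℂ) *ᵥ x := by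
  rw [star_dotProduct_mulVec_eq_ofReal, he.re_dotProduct_map h1 hy hxy, he.scalarMap_eq h1,
    ← star_dotProduct_mulVec_eq_ofReal]

/-- A unital triple isomorphism is real linear. -/
lemma exists_linearMap [Nontrivial ι] (he : IsTripleIso e) (h1 : e 1 = 1) :
    ∃ L : Herm ι →ₗ[ℝ] Herm ι, ∀ A, L A = e A := by
  refine ⟨⟨⟨e, fun A B => Subtype.ext (eq_of_trace_rankOne fun y hy => ?_)⟩,
    fun r A => Subtype.ext (eq_of_trace_rankOne fun y hy => ?_)⟩, fun A => rfl⟩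
  all_goals
    obtain ⟨x, hx, hxy⟩ := he.exists_ofVec_eq_map h1 hy
    have key := he.dotProduct_map h1 hy hxy
    simp only [trace_rankOne_mul]
  · rw [key, AddMemClass.coe_add, AddMemClass.coe_add, add_mulVec, add_mulVec, dotProduct_add,
      dotProduct_add, key, key]
  · change star y ⬝ᵥ (e (r • A) : Matrix ι ι ℂ) *ᵥ y
      = star y ⬝ᵥ ((r • e A : Herm ι) : Matrix ι ι ℂ) *ᵥ y
    rw [key, coe_smul_real, coe_smul_real, smul_mulVec, smul_mulVec, dotProduct_smul,
      dotProduct_smul, key]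

end IsTripleIso
end Herm

/-! ### Jordan maps of the full matrix algebra -/

/-- If `u x v + v x u = 0` for all `x`, then `u = 0` or `v = 0`. -/
lemma Matrix.eq_zero_or_eq_zero_of_mul_mul_add {u v : Matrix ι ι ℂ}
    (h : ∀ x, u * x * v + v * x * u = 0) : u = 0 ∨ v = 0 := by
  have he : ∀ i j k l, u i j * v k l + v i j * u k l = 0 := fun i j k l => by
    simpa [mul_apply, single_apply, Finset.sum_ite, ite_and, Finset.filter_eq'] using
      congrFun (congrFun (h (single j k 1)) i) l
  by_contra! hc
  obtain ⟨i, j, hij⟩ : ∃ i j, u i j ≠ 0 := by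
    by_contra! h0
    exact hc.1 (Matrix.ext h0)
  refine hc.2 (Matrix.ext fun k l => ?_)
  have h1 := he i j i j
  have h2 : v i j = 0 := by
    have : 2 * (u i j * v i j) = 0 := by linear_combination h1
    simpa [hij] using this
  have h3 := he i j k l
  rw [h2, zero_mul, add_zero] at h3
  exact (mul_eq_zero.1 h3).resolve_left hij

/-- If every element lies in one of two additive subgroups, one of them is everything. -/
lemma AddSubgroup.eq_top_or_eq_top {G : Type*} [AddCommGroup G] (H K : AddSubgroup G)
    (h : ∀ x, x ∈ H ∨ x ∈ K) : (∀ x, x ∈ H) ∨ (∀ x, x ∈ K) := by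
  by_contra! hc
  obtain ⟨⟨a, ha⟩, b, hb⟩ := hc
  have haK := (h a).resolve_left ha
  have hbH := (h b).resolve_right hb
  rcases h (a + b) with h1 | h1
  · exact ha ((H.add_mem_cancel_right hbH).1 h1)
  · exact hb ((K.add_mem_cancel_left haK).1 h1)

/-- A surjective unital Jordan endomorphism of a complex matrix algebra is multiplicative or
antimultiplicative. -/
lemma map_mul_or_map_mul_rev (Φ : Matrix ι ι ℂ →ₗ[ℂ] Matrix ι ι ℂ) (hsurj : Function.Surjective Φ)
    (h1 : Φ 1 = 1)
    (hT : ∀ X Y Z, Φ (X * Y * Z + Z * Y * X) = Φ X * Φ Y * Φ Z + Φ Z * Φ Y * Φ X) :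
    (∀ a b, Φ (a * b) = Φ a * Φ b) ∨ (∀ a b, Φ (a * b) = Φ b * Φ a) := by
  have hJ : ∀ a b, Φ (b * a) = Φ a * Φ b + Φ b * Φ a - Φ (a * b) := fun a b => by
    have := hT a 1 b
    simp only [Matrix.mul_one, h1, map_add] at this
    rw [← this]; abel
  have hT2 : ∀ X Y, Φ (X * Y * X) = Φ X * Φ Y * Φ X := fun X Y => by
    have := hT X Y X
    rw [← two_smul ℂ, ← two_smul ℂ, map_smul] at this
    exact smul_right_injective _ (two_ne_zero (α := ℂ)) this
  -- Computing Φ(ab·x·ba + ba·x·ab) in two ways gives uyv + vyu = 0 for the two differences u, v and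
  -- y = Φ(x).
  have hab : ∀ a b, Φ (a * b) - Φ a * Φ b = 0 ∨ Φ (a * b) - Φ b * Φ a = 0 := by
    intro a b
    refine Matrix.eq_zero_or_eq_zero_of_mul_mul_add fun y => ?_
    obtain ⟨x, rfl⟩ := hsurj y
    have e1 := hT (a * b) x (b * a)
    have e2 : Φ (a * b * x * (b * a) + b * a * x * (a * b))
        = Φ a * (Φ b * Φ x * Φ b) * Φ a + Φ b * (Φ a * Φ x * Φ a) * Φ b := by
      rw [← hT2, ← hT2, ← hT2, ← hT2, ← map_add]
      congr 1
      noncomm_ring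
    rw [e2, hJ a b] at e1
    rw [← sub_eq_zero] at e1
    rw [← e1]
    noncomm_ring
  let H : Matrix ι ι ℂ → AddSubgroup (Matrix ι ι ℂ) := fun a =>
    (Φ.toAddMonoidHom.comp (AddMonoidHom.mulLeft a)
      - (AddMonoidHom.mulLeft (Φ a)).comp Φ.toAddMonoidHom).ker
  let K : Matrix ι ι ℂ → AddSubgroup (Matrix ι ι ℂ) := fun a =>
    (Φ.toAddMonoidHom.comp (AddMonoidHom.mulLeft a)
      - (AddMonoidHom.mulRight (Φ a)).comp Φ.toAddMonoidHom).ker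
  have hH : ∀ a b, b ∈ H a ↔ Φ (a * b) - Φ a * Φ b = 0 := fun a b => Iff.rfl
  have hK : ∀ a b, b ∈ K a ↔ Φ (a * b) - Φ b * Φ a = 0 := fun a b => Iff.rfl
  let H' : AddSubgroup (Matrix ι ι ℂ) :=
    { carrier := {a | ∀ b, b ∈ H a}
      zero_mem' := fun b => by simp [hH]
      add_mem' := fun {a a'} ha ha' b => by
        have := congrArg₂ (· + ·) ((hH a b).1 (ha b)) ((hH a' b).1 (ha' b))
        rw [hH, Matrix.add_mul, map_add, map_add, Matrix.add_mul]
        simpa [sub_add_sub_comm] using this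
      neg_mem' := fun {a} ha b => by
        have := congrArg (- ·) ((hH a b).1 (ha b))
        rw [hH, Matrix.neg_mul, map_neg, map_neg, Matrix.neg_mul]
        simpa [neg_add_eq_sub] using this }
  let K' : AddSubgroup (Matrix ι ι ℂ) :=
    { carrier := {a | ∀ b, b ∈ K a}
      zero_mem' := fun b => by simp [hK]
      add_mem' := fun {a a'} ha ha' b => by
        have := congrArg₂ (· + ·) ((hK a b).1 (ha b)) ((hK a' b).1 (ha' b))
        rw [hK, Matrix.add_mul, map_add, map_add, Matrix.mul_add]
        simpa [sub_add_sub_comm] using this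
      neg_mem' := fun {a} ha b => by
        have := congrArg (- ·) ((hK a b).1 (ha b))
        rw [hK, Matrix.neg_mul, map_neg, map_neg, Matrix.mul_neg]
        simpa [neg_add_eq_sub] using this }
  -- The alternative in `hab` is made uniform first in b, for each fixed a, and then in a.
  rcases AddSubgroup.eq_top_or_eq_top H' K' fun a =>
    AddSubgroup.eq_top_or_eq_top (H a) (K a) fun b => hab a b with h | h
  · exact Or.inl fun a b => sub_eq_zero.1 (h a b)
  · exact Or.inr fun a b => sub_eq_zero.1 (h a b)

/-- A linear multiplicative star-preserving map of complex matrices sending a diagonal matrix unit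
to a rank-one projection is conjugation by a unitary. -/
lemma exists_unitary_of_map_mul (Φ : Matrix ι ι ℂ →ₗ[ℂ] Matrix ι ι ℂ)
    (hmul : ∀ a b, Φ (a * b) = Φ a * Φ b) (hstar : ∀ a, Φ aᴴ = (Φ a)ᴴ)
    (k : ι) {u : ι → ℂ} (hu : star u ⬝ᵥ u = 1) (hk : Φ (single k k 1) = rankOne u) :
    ∃ U ∈ unitaryGroup ι ℂ, ∀ A, Φ A = U * A * Uᴴ := by
  -- These are the columns of U; orthonormality comes from Φ(Eᵢₖ)*Φ(Eⱼₖ) = Φ(EₖᵢEⱼₖ).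
  let w : ι → ι → ℂ := fun i => Φ (single i k 1) *ᵥ u
  have hku : Φ (single k k 1) *ᵥ u = u := by
    rw [hk, rankOne, vecMulVec_mulVec, hu]; simp
  have hw : ∀ i j, star (w i) ⬝ᵥ w j = if i = j then 1 else 0 := by
    intro i j
    simp only [w]
    rw [star_mulVec, ← hstar, ← dotProduct_mulVec, mulVec_mulVec, ← hmul]
    rcases eq_or_ne i j with rfl | hij
    · simp [hku, hu]
    · simp [hij]
  let U : Matrix ι ι ℂ := of fun a i => w i a
  have hU : Uᴴ * U = 1 := by
    ext i j
    have : (Uᴴ * U) i j = star (w i) ⬝ᵥ w j := by simp [U, mul_apply, dotProduct]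
    rw [this, hw, Matrix.one_apply]
  have hUcol : ∀ i, U *ᵥ Pi.single i 1 = w i := fun i => by
    rw [mulVec_single_one]; rfl
  have hint : Φ ∘ₗ LinearMap.id = LinearMap.mulLeft ℂ U ∘ₗ LinearMap.mulRight ℂ Uᴴ := by
    refine Matrix.ext_linearMap ℂ fun i j => LinearMap.ext_ring ?_
    have h : Φ (single i j 1) * U = U * single i j 1 := by
      refine Matrix.ext_of_mulVec_single fun l => ?_
      rw [← mulVec_mulVec, ← mulVec_mulVec, hUcol]
      simp only [w]
      rw [mulVec_mulVec, ← hmul, single_mulVec]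
      rcases eq_or_ne j l with rfl | hjl
      · rw [single_mul_single_same, Pi.single_eq_same, one_mul]
        exact (hUcol i).symm
      · simp [hjl]
    have h2 := congrArg (· * Uᴴ) h
    simp only [Matrix.mul_assoc, mul_eq_one_comm.1 hU, Matrix.mul_one] at h2
    simpa [Matrix.mul_assoc] using h2
  refine ⟨U, mem_unitaryGroup_iff'.2 hU, fun A => ?_⟩
  simpa [Matrix.mul_assoc] using LinearMap.congr_fun hint A

/-! ### Complexification and conclusion -/

namespace Herm

/-- The complex linear extension of a real linear map of hermitian matrices. -/
noncomputable def complexify (L : Herm ι →ₗ[ℝ] Herm ι) : Matrix ι ι ℂ →ₗ[ℂ] Matrix ι ι ℂ where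
  toFun X := (L (ℜ X) : Matrix ι ι ℂ) + Complex.I • (L (ℑ X) : Matrix ι ι ℂ)
  map_add' X Y := by
    simp only [map_add, AddMemClass.coe_add, smul_add]
    abel
  map_smul' c X := by
    simp only [realPart_smul, imaginaryPart_smul, map_add, map_sub, map_smul,
      AddSubgroupClass.coe_sub, AddMemClass.coe_add, coe_smul_real, RingHom.id_apply]
    ext i j
    simp only [Matrix.add_apply, Matrix.sub_apply, Matrix.smul_apply, smul_eq_mul]
    linear_combination (-(c.im : ℂ) * (L (ℑ X) : Matrix ι ι ℂ) i j) * Complex.I_mul_I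
      + ((L (ℜ X) : Matrix ι ι ℂ) i j + Complex.I * (L (ℑ X) : Matrix ι ι ℂ) i j)
        * Complex.re_add_im c

@[simp] lemma complexify_coe (L : Herm ι →ₗ[ℝ] Herm ι) (A : Herm ι) :
    complexify L (A : Matrix ι ι ℂ) = L A := by
  simp [complexify]

/-- Induction principle reducing to hermitian matrices. -/
lemma matrix_induction {p : Matrix ι ι ℂ → Prop} (hS : ∀ A : Herm ι, p A)
    (hadd : ∀ X Y, p X → p Y → p (X + Y)) (hI : ∀ X, p X → p (Complex.I • X)) (X) : p X := by
  rw [← realPart_add_I_smul_imaginaryPart X]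
  exact hadd _ _ (hS _) (hI _ (hS _))

lemma complexify_conjTranspose (L : Herm ι →ₗ[ℝ] Herm ι) (X : Matrix ι ι ℂ) :
    complexify L Xᴴ = (complexify L X)ᴴ := by
  induction X using matrix_induction with
  | hS A => rw [complexify_coe, star_coe, complexify_coe, star_coe]
  | hadd X Y hX hY => simp [hX, hY]
  | hI X hX => simp [hX]

lemma complexify_surjective {L : Herm ι →ₗ[ℝ] Herm ι} (hL : Function.Surjective L) :
    Function.Surjective (complexify L) := by
  intro X
  induction X using matrix_induction with
  | hS A =>
    obtain ⟨B, rfl⟩ := hL A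
    exact ⟨B, complexify_coe L B⟩
  | hadd X Y hX hY =>
    obtain ⟨A, rfl⟩ := hX
    obtain ⟨B, rfl⟩ := hY
    exact ⟨A + B, map_add _ _ _⟩
  | hI X hX =>
    obtain ⟨A, rfl⟩ := hX
    exact ⟨Complex.I • A, map_smul _ _ _⟩

/-- Polarizing ABA in A gives ABC + CBA, which is complex trilinear and so extends from hermitian
arguments. -/
lemma complexify_triple {L : Herm ι →ₗ[ℝ] Herm ι}
    (hL : ∀ A B, L (jtriple A B) = jtriple (L A) (L B)) (X Y Z : Matrix ι ι ℂ) :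
    complexify L (X * Y * Z + Z * Y * X) = complexify L X * complexify L Y * complexify L Z
      + complexify L Z * complexify L Y * complexify L X := by
  have h0 : ∀ A B C : Herm ι, jtriple (A + C) B - jtriple A B - jtriple C B
      = (A : Matrix ι ι ℂ) * B * C + (C : Matrix ι ι ℂ) * B * A := fun A B C => by
    simp
    noncomm_ring
  induction X using matrix_induction with
  | hS A =>
    induction Y using matrix_induction with
    | hS B =>
      induction Z using matrix_induction with
      | hS C =>
        rw [← h0]
        simp only [map_sub, complexify_coe]
        rw [hL, hL, hL, ← h0, map_add]
      | hadd X Y hX hY =>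
        simp only [Matrix.mul_add, Matrix.add_mul, map_add] at hX hY ⊢
        rw [add_add_add_comm, hX, hY]; abel
      | hI X hX =>
        simp only [Matrix.mul_smul, Matrix.smul_mul, ← smul_add, map_smul, hX]
    | hadd X Y hX hY =>
      simp only [Matrix.mul_add, Matrix.add_mul, map_add] at hX hY ⊢
      rw [add_add_add_comm, hX, hY]; abel
    | hI X hX => simp only [Matrix.mul_smul, Matrix.smul_mul, ← smul_add, map_smul, hX]
  | hadd X Y hX hY =>
    simp only [Matrix.mul_add, Matrix.add_mul, map_add] at hX hY ⊢
    rw [add_add_add_comm, hX, hY]; abel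
  | hI X hX => simp only [Matrix.mul_smul, Matrix.smul_mul, ← smul_add, map_smul, hX]

/-- A unital bijection of the hermitian matrices multiplicative for the Jordan triple product is
a unitary conjugation, possibly composed with transposition. -/
theorem IsTripleIso.exists_unitary [Nontrivial ι] {e : Herm ι ≃ Herm ι} (he : IsTripleIso e)
    (h1 : e 1 = 1) : ∃ U ∈ unitaryGroup ι ℂ,
      (∀ A : Herm ι, (e A : Matrix ι ι ℂ) = U * (A : Matrix ι ι ℂ) * Uᴴ) ∨
      (∀ A : Herm ι, (e A : Matrix ι ι ℂ) = U * (A : Matrix ι ι ℂ)ᵀ * Uᴴ) := by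
  obtain ⟨L, hL⟩ := he.exists_linearMap h1
  have hLs : Function.Surjective L := fun A =>
    ⟨e.symm A, by rw [hL, e.apply_symm_apply]⟩
  set Φ := complexify L
  have hΦ : ∀ A : Herm ι, Φ (A : Matrix ι ι ℂ) = e A := fun A => by
    rw [complexify_coe, hL]
  have hΦ1 : Φ 1 = 1 := by
    have := hΦ 1
    rwa [h1] at this
  have hstar := complexify_conjTranspose L
  obtain ⟨k⟩ := (inferInstance : Nonempty ι)
  obtain ⟨u, hu, hku⟩ := he.exists_map_ofVec h1 (x := Pi.single k 1) (by simp)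
  have hk : Φ (single k k 1) = rankOne u := by
    rw [← rankOne_single, ← coe_ofVec, hΦ, hku, coe_ofVec]
  rcases map_mul_or_map_mul_rev Φ (complexify_surjective hLs) hΦ1
    (complexify_triple fun A B => by simp only [hL, he A B]) with h | h
  · obtain ⟨U, hU, h⟩ := exists_unitary_of_map_mul Φ h hstar k hu hk
    exact ⟨U, hU, Or.inl fun A => by rw [← hΦ, h]⟩
  -- Precomposing with transposition makes Φ multiplicative and fixes the matrix unit at (k, k).
  · obtain ⟨U, hU, h⟩ := exists_unitary_of_map_mul
      (Φ ∘ₗ (transposeLinearEquiv ι ι ℂ ℂ).toLinearMap) (fun a b => by simp [h])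
      (fun a => hstar aᵀ) k hu (by simpa using hk)
    exact ⟨U, hU, Or.inr fun A => by rw [← hΦ, ← h]; simp⟩

end Herm

end

theorem theorem2p3 (n : ℕ) (hn : 2 ≤ n) (φ : HermMat n → HermMat n)
    (hbij : Function.Bijective φ)
    (hφ : ∀ A B : HermMat n, φ (A.triple B) = (φ A).triple (φ B)) :
    ∃ c : ℂ, (c = -1 ∨ c = 1) ∧ ∃ U ∈ Matrix.unitaryGroup (Fin n) ℂ,
      (∀ A : HermMat n, (φ A).1 = c • (U * A.1 * U.conjTranspose)) ∨
      (∀ A : HermMat n, (φ A).1 = c • (U * A.1.transpose * U.conjTranspose)) := by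
  have : Nontrivial (Fin n) := Fin.nontrivial_iff_two_le.2 hn
  let e : Herm (Fin n) ≃ Herm (Fin n) := Equiv.ofBijective φ hbij
  have he : Herm.IsTripleIso e := hφ
  rcases he.map_one with h1 | h1
  · obtain ⟨U, hU, h⟩ := he.exists_unitary h1
    exact ⟨1, Or.inr rfl, U, hU, by simp only [one_smul]; exact h⟩
  -- The triple product has odd degree, so the negated map is again a triple isomorphism, now
  -- unital.
  · obtain ⟨U, hU, h⟩ := he.neg.exists_unitary (by simp [h1])
    refine ⟨-1, Or.inl rfl, U, hU, ?_⟩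
    simp only [neg_one_smul, ← neg_eq_iff_eq_neg]
    exact h
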